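/- Let $n\ge 0$ and $m\ge 2$ be integers, let $c^1,\dots,c^m\in\mathbb R^n$ and $r_1,\dots,r_m\ge 0$ be the centres and radii of $m$ balls, and let $\|\cdot\|$ be the Euclidean norm. Let $\mathbb L^{n+2}=\{v\in\mathbb R^{n+2}:\|(v_1,\dots,v_{n+1})\|\le v_{n+2}\}$ and $$Q=\begin{bmatrix}-2I&0&0\\0&0&1\\0&1&0\end{bmatrix},\qquad P=\begin{bmatrix}2I&0&0\\0&1&-1\\0&1&1\end{bmatrix},\qquad d^i=\begin{bmatrix}2c^i\\-1\\r_i^2-\|c^i\|^2\end{bmatrix},$$ where $I$ is the $n\times n$ identity matrix. For symmetric $Z\in\mathbb R^{(n+2)\times(n+2)}$ let $\langle Q,Z\rangle=\operatorname{tr}(QZ)$, let $\pi_X(Z)$ be the leading $n\times n$ block of $Z$ and $\pi_x(Z)=(Z_{1,n+2},\dots,Z_{n,n+2})^\top$. Define $$\mathcal C_m=\{Z\succeq0:\ \langle Q,Z\rangle=0,\ PZd^i\in\mathbb L^{n+2}\ \forall i,\ (d^i)^\top Zd^j\ge0\ \forall i,j\},$$ $$\mathcal C_{\{i,j\}}=\{Z\succeq0:\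 \langle Q,Z\rangle=0,\ PZd^i\in\mathbb L^{n+2},\ PZd^j\in\mathbb L^{n+2},\ (d^i)^\top Zd^j\ge0\}.$$ For $u\in\mathbb R^n$ and $\rho\in\mathbb R$ let $\mathcal A(u,\rho)=\begin{bmatrix}\rho I&u\\u^\top&\rho\end{bmatrix}$. Expand the entries of $\mathcal A(x-c^i,r_i)\otimes\mathcal A(x-c^j,r_j)$ as polynomials of degree at most $2$ in $x$. Let $\widehat{\mathcal K}_{ij}(X,x,x_0)$ be the linear map obtained by replacing each product $x_kx_l$ by $X_{kl}$ and multiplying the constant terms by $x_0$, and let $\mathcal K_{ij}(X,x)=\widehat{\mathcal K}_{ij}(X,x,1)$ be Anstreicher's Kronecker map. Then: 1. For all $i\ne j$ and all $Z\in\mathcal C_{\{i,j\}}$, $\widehat{\mathcal K}_{ij}(\pi_X(Z),\pi_x(Z),Z_{n+2,n+2})\succeq0$. In particular, if $Z_{n+2,n+2}=1$, then $\mathcal K_{ij}(\pi_X(Z),\pi_x(Z))\succeq0$. 2. $\mathcal C_m=\bigcap_{i}\bigcap_{j<i}\mathcal C_{\{i,j\}}$. 3. For all $Z\in\mathcal C_m$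 and all $i,j$ (including $i=j$), $\widehat{\mathcal K}_{ij}(\pi_X(Z),\pi_x(Z),Z_{n+2,n+2})\succeq0$. In particular, if $Z_{n+2,n+2}=1$, then $\mathcal K_{ij}(\pi_X(Z),\pi_x(Z))\succeq0$. That is, Burer's lifted relaxation $\mathcal C_m\cap\{Z_{n+2,n+2}=1\}$ implies all Kronecker RLT inequalities. -/

import Mathlib

open scoped Kronecker

namespace BallQP

/-- Coordinates of `ℝ^(n+2)`, whose vectors are written `w = (x, t, x₀)`: the first `n` coordinates
are `Sum.inl k`, the coordinate `n+1` (`t`) is `Sum.inr 0`, the coordinate `n+2` (`x₀`) is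
`Sum.inr 1`. -/
abbrev Idx (n : ℕ) := Fin n ⊕ Fin 2

/-- The second-order cone of `ℝ^(n+2)`: the Euclidean norm of the first `n+1` coordinates is at most
the last coordinate. -/
def lorentz (n : ℕ) : Set (Idx n → ℝ) :=
  {v | √(∑ k, v (Sum.inl k) ^ 2 + v (Sum.inr 0) ^ 2) ≤ v (Sum.inr 1)}

/-- `Q = [-2I 0 0; 0 0 1; 0 1 0]`. -/
def Q (n : ℕ) : Matrix (Idx n) (Idx n) ℝ :=
  Matrix.fromBlocks ((-2 : ℝ) • 1) 0 0 !![0, 1; 1, 0]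

/-- `P = [2I 0 0; 0 1 -1; 0 1 1]`. -/
def P (n : ℕ) : Matrix (Idx n) (Idx n) ℝ :=
  Matrix.fromBlocks ((2 : ℝ) • 1) 0 0 !![1, -1; 1, 1]

/-- `d = (2c, -1, ρ² - ‖c‖²)` for the ball with centre `c` and radius `ρ`. -/
noncomputable def dvec {n : ℕ} (c : EuclideanSpace ℝ (Fin n)) (ρ : ℝ) : Idx n → ℝ :=
  Sum.elim (fun k => 2 * c k) ![-1, ρ ^ 2 - ‖c‖ ^ 2]

/-- The lifted set `C_m` of all `m` balls. -/
def lifted {n m : ℕ} (c : Fin m → EuclideanSpace ℝ (Fin n)) (r : Fin m → ℝ) :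
    Set (Matrix (Idx n) (Idx n) ℝ) :=
  {Z | Z.PosSemidef ∧ Matrix.trace (Q n * Z) = 0 ∧
    (∀ i, (P n * Z).mulVec (dvec (c i) (r i)) ∈ lorentz n) ∧
    ∀ i j, 0 ≤ dvec (c i) (r i) ⬝ᵥ Z.mulVec (dvec (c j) (r j))}

/-- The pairwise set `C_{i,j}`. -/
def liftedPair {n m : ℕ} (c : Fin m → EuclideanSpace ℝ (Fin n)) (r : Fin m → ℝ) (i j : Fin m) :
    Set (Matrix (Idx n) (Idx n) ℝ) :=
  {Z | Z.PosSemidef ∧ Matrix.trace (Q n * Z) = 0 ∧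
    (P n * Z).mulVec (dvec (c i) (r i)) ∈ lorentz n ∧
    (P n * Z).mulVec (dvec (c j) (r j)) ∈ lorentz n ∧
    0 ≤ dvec (c i) (r i) ⬝ᵥ Z.mulVec (dvec (c j) (r j))}

/-- `π_X(Z)`: the leading `n × n` block. -/
def projX {n : ℕ} (Z : Matrix (Idx n) (Idx n) ℝ) : Matrix (Fin n) (Fin n) ℝ :=
  Matrix.of fun k l => Z (Sum.inl k) (Sum.inl l)

/-- `π_x(Z)`: the first `n` entries of the last column. -/
def projx {n : ℕ} (Z : Matrix (Idx n) (Idx n) ℝ) : EuclideanSpace ℝ (Fin n) :=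
  WithLp.toLp 2 fun k => Z (Sum.inl k) (Sum.inr 1)

/-- The entry `Z_{n+2,n+2}`. -/
def lastEntry {n : ℕ} (Z : Matrix (Idx n) (Idx n) ℝ) : ℝ := Z (Sum.inr 1) (Sum.inr 1)

/-- The `(n+1) × (n+1)` arrow matrix `A(u, ρ) = [ρI u; uᵀ ρ]`. -/
def arrow {n : ℕ} (u : EuclideanSpace ℝ (Fin n)) (ρ : ℝ) :
    Matrix (Fin n ⊕ Unit) (Fin n ⊕ Unit) ℝ :=
  Matrix.fromBlocks (ρ • 1) (Matrix.of fun k _ => u k) (Matrix.of fun _ k => u k) (ρ • 1)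

/-- Homogenized Kronecker map. Since `A(x - a, ρ) = A(-a, ρ) + ∑ k, x_k A(e_k, 0)`, the product
`A(x - a, ρ) ⊗ A(x - b, σ)` expands into a constant part, a part that is linear in `x` and a part
that is quadratic in `x`. The products `x_k x_l` are replaced by `X_kl`, and the constant part is
multiplied by the homogenizing variable `x₀`. -/
noncomputable def kronHom {n : ℕ} (a : EuclideanSpace ℝ (Fin n)) (ρ : ℝ) (b : EuclideanSpace ℝ (Fin n)) (σ : ℝ)
    (X : Matrix (Fin n) (Fin n) ℝ) (x : EuclideanSpace ℝ (Fin n)) (x₀ : ℝ) :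
    Matrix ((Fin n ⊕ Unit) × (Fin n ⊕ Unit)) ((Fin n ⊕ Unit) × (Fin n ⊕ Unit)) ℝ :=
  x₀ • (arrow (-a) ρ ⊗ₖ arrow (-b) σ)
    + ∑ k, x k • (arrow (EuclideanSpace.single k 1) 0 ⊗ₖ arrow (-b) σ
        + arrow (-a) ρ ⊗ₖ arrow (EuclideanSpace.single k 1) 0)
    + ∑ k, ∑ l, X k l •
        (arrow (EuclideanSpace.single k 1) 0 ⊗ₖ arrow (EuclideanSpace.single l 1) 0)

/-- The Kronecker map of the balls with centres `a`, `b` and radii `ρ`, `σ`: the affine map of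
`(X, x)` obtained from `A(x - a, ρ) ⊗ A(x - b, σ)` on replacing each `x_k x_l` by `X_kl`. -/
noncomputable def kron {n : ℕ} (a : EuclideanSpace ℝ (Fin n)) (ρ : ℝ) (b : EuclideanSpace ℝ (Fin n)) (σ : ℝ)
    (X : Matrix (Fin n) (Fin n) ℝ) (x : EuclideanSpace ℝ (Fin n)) :
    Matrix ((Fin n ⊕ Unit) × (Fin n ⊕ Unit)) ((Fin n ⊕ Unit) × (Fin n ⊕ Unit)) ℝ :=
  kronHom a ρ b σ X x 1

theorem arrow_sub {n : ℕ} (x a : EuclideanSpace ℝ (Fin n)) (ρ : ℝ) :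
    arrow (x - a) ρ = arrow (-a) ρ + ∑ k, x k • arrow (EuclideanSpace.single k 1) 0 := by
  ext p q
  rcases p with p | p <;> rcases q with q | q <;>
    simp [arrow, Matrix.sum_apply] <;> ring

/-- On `X = x xᵀ` the Kronecker map is the Kronecker product of the two arrow matrices. -/
theorem kron_vecMulVec {n : ℕ} (a : EuclideanSpace ℝ (Fin n)) (ρ : ℝ)
    (b : EuclideanSpace ℝ (Fin n)) (σ : ℝ) (x : EuclideanSpace ℝ (Fin n)) :
    kron a ρ b σ (Matrix.vecMulVec x x) x = arrow (x - a) ρ ⊗ₖ arrow (x - b) σ := by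
  rw [arrow_sub x a, arrow_sub x b]
  ext p q
  simp only [kron, kronHom, Matrix.add_apply, Matrix.smul_apply, Matrix.sum_apply,
    Matrix.kroneckerMap_apply, Matrix.vecMulVec_apply, smul_eq_mul, one_mul]
  rw [add_mul, mul_add, mul_add, Finset.sum_mul_sum, Finset.mul_sum, Finset.sum_mul]
  simp only [mul_add, Finset.sum_add_distrib]
  have h1 : ∀ k l : Fin n, x k * x l * (arrow (EuclideanSpace.single k 1) 0 p.1 q.1
      * arrow (EuclideanSpace.single l 1) 0 p.2 q.2)
      = x k * arrow (EuclideanSpace.single k 1) 0 p.1 q.1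
        * (x l * arrow (EuclideanSpace.single l 1) 0 p.2 q.2) := fun k l => by ring
  have h2 : ∀ k : Fin n, x k * (arrow (-a) ρ p.1 q.1 * arrow (EuclideanSpace.single k 1) 0 p.2 q.2)
      = arrow (-a) ρ p.1 q.1 * (x k * arrow (EuclideanSpace.single k 1) 0 p.2 q.2) :=
    fun k => by ring
  simp only [h1, h2, ← mul_assoc]
  ring

end BallQP

/-!
Write `Z = ∑ w wᵀ` with `w = (x, t, x₀)`. By linearity the homogenized Kronecker map takes `Z` to
`∑ A(w) ⊗ B(w)`, where `A(w) = A(x - x₀ a, ρ x₀)` and `B(w) = A(x - x₀ b, σ x₀)` are the homogenized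
arrow matrices of the two balls (`kronHom_sum_vecMulVec`).

Let `d`, `e` be the vectors of the two balls, and let `K = {w : P w ∈ 𝕃}`, the cone of points with
`‖x‖² ≤ t x₀` and `t, x₀ ≥ 0`. The key identity is
`2ρ A(w) = (d ⬝ w) I + A'(w)`, `2σ B(w) = (e ⬝ w) I + B'(w)`,
where the linear maps `A'` and `B'` are positive semidefinite on `K` (`ballRest_posSemidef`, an
arithmetic-geometric mean estimate). Expanding the product and summing over `w` gives
`4ρσ ∑ A(w) ⊗ B(w) = (dᵀ Z e) I + I ⊗ B'(Z d) + A'(Z e) ⊗ I + ∑ A'(w) ⊗ B'(w)`.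
The first three terms are positive semidefinite because `dᵀ Z e ≥ 0` and `Z d, Z e ∈ K`. In the last
sum the single terms are positive semidefinite wherever `wᵀ Q w ≥ 0`, since then `w ∈ K ∪ -K`; the
sum itself is positive semidefinite because `∑ wᵀ Q w = ⟨Q, Z⟩ = 0`. This last step is the S-lemma,
proved by rotating pairs of the vectors `w` until `wᵀ Q w ≥ 0` for all of them, which leaves
`∑ w wᵀ` unchanged (`sum_nonneg_of_nonneg_imp`).

A ball of radius `0` has to be treated apart, as the identity then says nothing about `A(w)`; but in
that case `A(w) = 0` for every `w` (`ballArrow_eq_zero`). The description of the lifted set as an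
intersection of pairwise sets holds because the pairwise sets are symmetric in the two balls, every
index belongs to some pair, and the diagonal constraints `dᵀ Z d ≥ 0` follow from `Z ⪰ 0`.
-/

namespace BallQP

open Matrix

/-! ### Summing quadratic forms -/

/-- If the quadratic form `q` has opposite signs at `u` and `v`, then `u`, `v` can be rotated to a
pair whose first member is `q`-isotropic. The rotation preserves `B u u + B v v` for every bilinear
form `B`. -/
theorem exists_rotation_isotropic {E : Type*} [AddCommGroup E] [Module ℝ E]
    (q : LinearMap.BilinForm ℝ E) {u v : E} (hu : q u u ≤ 0) (hv : 0 ≤ q v v) :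
    ∃ u' v' : E, q u' u' = 0 ∧
      ∀ B : LinearMap.BilinForm ℝ E, B u' u' + B v' v' = B u u + B v v := by
  let f : ℝ → ℝ := fun s => q ((1 - s) • u + s • v) ((1 - s) • u + s • v)
  have hf : ∀ s, f s = (1 - s) ^ 2 * q u u + (1 - s) * s * (q u v + q v u) + s ^ 2 * q v v := by
    intro s
    simp only [f, map_add, map_smul, LinearMap.add_apply, LinearMap.smul_apply, smul_eq_mul]
    ring
  -- `q` vanishes at some point of the segment from `u` to `v`; that point, divided by `N`, is
  -- the first rotated vector.
  have hc : Continuous f := by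
    rw [funext hf]
    fun_prop
  obtain ⟨s, -, hs⟩ := intermediate_value_Icc (zero_le_one' ℝ) hc.continuousOn
    (show (0 : ℝ) ∈ Set.Icc (f 0) (f 1) by simp [hf, hu, hv])
  have hpos : 0 < (1 - s) ^ 2 + s ^ 2 := by nlinarith [sq_nonneg (2 * s - 1)]
  set N := √((1 - s) ^ 2 + s ^ 2)
  have hN2 : N⁻¹ * N⁻¹ * ((1 - s) ^ 2 + s ^ 2) = 1 := by
    have h0 : N ≠ 0 := (Real.sqrt_pos.2 hpos).ne'
    have h1 : N * N = (1 - s) ^ 2 + s ^ 2 := Real.mul_self_sqrt hpos.le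
    rw [← h1]
    field_simp
  refine ⟨N⁻¹ • ((1 - s) • u + s • v), N⁻¹ • ((1 - s) • v - s • u), ?_, fun B => ?_⟩
  · have : q ((1 - s) • u + s • v) ((1 - s) • u + s • v) = 0 := hs
    simp only [map_smul, LinearMap.smul_apply, this, smul_zero]
  · simp only [map_add, map_sub, map_smul, LinearMap.add_apply, LinearMap.sub_apply,
      LinearMap.smul_apply, smul_eq_mul]
    linear_combination (B u u + B v v) * hN2

/-- Summation form of the homogeneous S-lemma: implication of nonnegativity between two quadratic
forms passes to sums over finite families, that is, to positive semidefinite matrices. -/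
theorem sum_nonneg_of_nonneg_imp {E ι : Type*} [AddCommGroup E] [Module ℝ E]
    (q g : LinearMap.BilinForm ℝ E) (h : ∀ w, 0 ≤ q w w → 0 ≤ g w w) (s : Finset ι) (w : ι → E)
    (hq : 0 ≤ ∑ i ∈ s, q (w i) (w i)) : 0 ≤ ∑ i ∈ s, g (w i) (w i) := by
  classical
  induction hn : s.card generalizing s w with
  | zero => simp [Finset.card_eq_zero.1 hn]
  | succ N ih =>
    by_cases hall : ∀ i ∈ s, 0 ≤ q (w i) (w i)
    · exact Finset.sum_nonneg fun i hi => h _ (hall i hi)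
    push Not at hall
    obtain ⟨a, ha, hqa⟩ := hall
    obtain ⟨b, hb, hqb⟩ : ∃ b ∈ s, 0 < q (w b) (w b) := by
      by_contra! hcon
      exact absurd hq (not_le.2 (Finset.sum_neg' hcon ⟨a, ha, hqa⟩))
    have hab : b ≠ a := by
      rintro rfl
      exact lt_asymm hqa hqb
    obtain ⟨u, v, hu, huv⟩ := exists_rotation_isotropic q hqa.le hqb.le
    have hbs : b ∈ s.erase a := Finset.mem_erase.2 ⟨hab, hb⟩
    -- Replacing `w a`, `w b` by `u`, `v` keeps both sums, and `u` can be split off.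
    have key : ∀ B : LinearMap.BilinForm ℝ E, ∑ i ∈ s, B (w i) (w i) =
        B u u + ∑ i ∈ s.erase a, B (Function.update w b v i) (Function.update w b v i) := by
      intro B
      rw [← Finset.add_sum_erase s _ ha, ← Finset.add_sum_erase _ _ hbs,
        ← Finset.add_sum_erase (s.erase a)
          (fun i => B (Function.update w b v i) (Function.update w b v i)) hbs]
      have : ∑ i ∈ (s.erase a).erase b, B (Function.update w b v i) (Function.update w b v i)
          = ∑ i ∈ (s.erase a).erase b, B (w i) (w i) :=
        Finset.sum_congr rfl fun i hi => by
          rw [Function.update_of_ne (Finset.ne_of_mem_erase hi)]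
      rw [this, Function.update_self]
      linarith [huv B]
    rw [key g]
    refine add_nonneg (h _ hu.ge) (ih _ _ ?_ ?_)
    · rwa [key q, hu, zero_add] at hq
    · rw [Finset.card_erase_of_mem ha, hn, Nat.add_sub_cancel]

/-- The Kronecker product of two matrix-valued linear maps, evaluated at a common argument and
tested on `z`, as a bilinear form. -/
noncomputable def kronForm {E κ : Type*} [AddCommGroup E] [Module ℝ E] [Fintype κ]
    (F G : E →ₗ[ℝ] Matrix κ κ ℝ) (z : κ × κ → ℝ) : LinearMap.BilinForm ℝ E :=
  LinearMap.mk₂ ℝ (fun u v => z ⬝ᵥ (F u ⊗ₖ G v) *ᵥ z)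
    (by simp [add_kronecker, add_mulVec, dotProduct_add])
    (by simp [smul_kronecker, smul_mulVec])
    (by simp [kronecker_add, add_mulVec, dotProduct_add])
    (by simp [kronecker_smul, smul_mulVec])

/-- Positive semidefiniteness of `F w ⊗ G w` on the set `q ≥ 0` passes to sums over finite families
on which `q` has nonnegative sum, although single members may violate `q ≥ 0`. -/
theorem posSemidef_sum_kronecker {E ι κ : Type*} [AddCommGroup E] [Module ℝ E] [Fintype κ]
    [Fintype ι] (q : LinearMap.BilinForm ℝ E) (F G : E →ₗ[ℝ] Matrix κ κ ℝ)
    (h : ∀ w, 0 ≤ q w w → (F w ⊗ₖ G w).PosSemidef)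
    (hF : ∀ w, (F w).IsHermitian) (hG : ∀ w, (G w).IsHermitian) (w : ι → E)
    (hq : 0 ≤ ∑ i, q (w i) (w i)) : (∑ i, F (w i) ⊗ₖ G (w i)).PosSemidef := by
  refine PosSemidef.of_dotProduct_mulVec_nonneg ?_ fun z => ?_
  · rw [IsHermitian, conjTranspose_sum]
    exact Finset.sum_congr rfl fun i _ => by rw [conjTranspose_kronecker, hF, hG]
  · have := sum_nonneg_of_nonneg_imp q (kronForm F G z)
      (fun v hv => by simpa [kronForm] using (h v hv).dotProduct_mulVec_nonneg z)
      Finset.univ w hq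
    simpa [kronForm, sum_mulVec, dotProduct_sum] using this

/-! ### Arrow matrices -/

theorem arrow_isHermitian {n : ℕ} (u : EuclideanSpace ℝ (Fin n)) (ρ : ℝ) :
    (arrow u ρ).IsHermitian := by
  rw [arrow, IsHermitian, fromBlocks_conjTranspose]
  congr 1
  all_goals
    ext
    simp [one_apply, eq_comm]

theorem arrow_posSemidef {n : ℕ} {u : EuclideanSpace ℝ (Fin n)} {ρ : ℝ} (h : ‖u‖ ≤ ρ) :
    (arrow u ρ).PosSemidef := by
  refine PosSemidef.of_dotProduct_mulVec_nonneg (arrow_isHermitian u ρ) fun z => ?_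
  let y : EuclideanSpace ℝ (Fin n) := WithLp.toLp 2 fun k => z (Sum.inl k)
  let t := z (Sum.inr ())
  have hz : star z ⬝ᵥ arrow u ρ *ᵥ z = ρ * ‖y‖ ^ 2 + 2 * t * inner ℝ u y + ρ * t ^ 2 := by
    rw [EuclideanSpace.norm_sq_eq, PiLp.inner_apply]
    simp only [arrow, star_trivial, dotProduct, mulVec, Fintype.sum_sum_type, fromBlocks_apply₁₁,
      fromBlocks_apply₁₂, fromBlocks_apply₂₁, fromBlocks_apply₂₂, Matrix.smul_apply, one_apply, of_apply,
      Finset.univ_unique, Finset.sum_singleton, smul_eq_mul, mul_ite, mul_one, mul_zero, ite_mul,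
      zero_mul, Finset.sum_ite_eq, Finset.mem_univ, if_true, y, t, PUnit.default_eq_unit,
      RCLike.inner_apply, conj_trivial, Real.norm_eq_abs, sq_abs, Finset.mul_sum, mul_add,
      Finset.sum_add_distrib]
    have h1 : ∀ k, z (Sum.inl k) * (ρ * z (Sum.inl k)) = ρ * z (Sum.inl k) ^ 2 := fun k => by ring
    have h2 : ∀ k, 2 * z (Sum.inr ()) * (z (Sum.inl k) * u k)
        = z (Sum.inl k) * (u k * z (Sum.inr ())) + z (Sum.inr ()) * (u k * z (Sum.inl k)) :=
      fun k => by ring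
    simp only [h1, h2, Finset.sum_add_distrib]
    ring
  rw [hz]
  have hin : |inner ℝ u y| ≤ ρ * ‖y‖ :=
    (abs_real_inner_le_norm u y).trans (mul_le_mul_of_nonneg_right h (norm_nonneg y))
  have hρ : 0 ≤ ρ := (norm_nonneg u).trans h
  have h3 : |t * inner ℝ u y| ≤ |t| * (ρ * ‖y‖) := by
    rw [abs_mul]
    exact mul_le_mul_of_nonneg_left hin (abs_nonneg t)
  have h4 := neg_abs_le (t * inner ℝ u y)
  have h5 : 0 ≤ ρ * (‖y‖ - |t|) ^ 2 := mul_nonneg hρ (sq_nonneg _)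
  nlinarith [sq_abs t]

/-! ### The cone of homogenized paraboloid points -/

/-- The first `n` coordinates of `w = (x, t, x₀)`. -/
def xpart {n : ℕ} (w : Idx n → ℝ) : EuclideanSpace ℝ (Fin n) :=
  WithLp.toLp 2 fun k => w (Sum.inl k)

/-- `P w` lies in the second-order cone iff `w = (x, t, x₀)` lies in the paraboloid cone
`‖x‖² ≤ t x₀`, `t, x₀ ≥ 0`; given the quadratic inequality, the two signs amount to
`0 ≤ t + x₀`. -/
theorem mulVec_P_mem_lorentz_iff {n : ℕ} (w : Idx n → ℝ) :
    P n *ᵥ w ∈ lorentz n ↔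
      0 ≤ w (Sum.inr 0) + w (Sum.inr 1) ∧ ‖xpart w‖ ^ 2 ≤ w (Sum.inr 0) * w (Sum.inr 1) := by
  have h1 : ∀ k, (P n *ᵥ w) (Sum.inl k) = 2 * w (Sum.inl k) := by
    intro k
    simp [P, mulVec, dotProduct, Fintype.sum_sum_type, one_apply]
  have h2 : (P n *ᵥ w) (Sum.inr 0) = w (Sum.inr 0) - w (Sum.inr 1) := by
    simp [P, mulVec, dotProduct, Fintype.sum_sum_type, Fin.sum_univ_two]
    ring
  have h3 : (P n *ᵥ w) (Sum.inr 1) = w (Sum.inr 0) + w (Sum.inr 1) := by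
    simp [P, mulVec, dotProduct, Fintype.sum_sum_type, Fin.sum_univ_two]
  have hx : ‖xpart w‖ ^ 2 = ∑ k, w (Sum.inl k) ^ 2 := by
    simp [EuclideanSpace.norm_sq_eq, xpart]
  have h4 : ∑ k, (P n *ᵥ w) (Sum.inl k) ^ 2 = 4 * ‖xpart w‖ ^ 2 := by
    rw [hx, Finset.mul_sum]
    exact Finset.sum_congr rfl fun k _ => by rw [h1]; ring
  rw [lorentz, Set.mem_ofPred_eq, h4, h2, h3, Real.sqrt_le_iff]
  refine and_congr_right fun _ => ?_
  constructor <;> intro h <;> nlinarith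

theorem toBilin'_Q {n : ℕ} (w : Idx n → ℝ) :
    Matrix.toBilin' (Q n) w w = 2 * (w (Sum.inr 0) * w (Sum.inr 1) - ‖xpart w‖ ^ 2) := by
  have hx : ‖xpart w‖ ^ 2 = ∑ k, w (Sum.inl k) ^ 2 := by
    simp [EuclideanSpace.norm_sq_eq, xpart]
  rw [hx, Matrix.toBilin'_apply']
  simp only [Q, dotProduct, mulVec, Fintype.sum_sum_type, Fin.sum_univ_two, fromBlocks_apply₁₁,
    fromBlocks_apply₁₂, fromBlocks_apply₂₁, fromBlocks_apply₂₂, Matrix.smul_apply, one_apply]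
  simp [mul_sub, Finset.mul_sum]
  rw [← sub_eq_zero]
  have : ∀ k, w (Sum.inl k) * (2 * w (Sum.inl k)) = 2 * w (Sum.inl k) ^ 2 := fun k => by ring
  simp only [this]
  ring

theorem dvec_dotProduct {n : ℕ} (c : EuclideanSpace ℝ (Fin n)) (ρ : ℝ) (w : Idx n → ℝ) :
    dvec c ρ ⬝ᵥ w
      = 2 * inner ℝ c (xpart w) - w (Sum.inr 0) + (ρ ^ 2 - ‖c‖ ^ 2) * w (Sum.inr 1) := by
  simp only [dvec, dotProduct, Fintype.sum_sum_type, Fin.sum_univ_two, PiLp.inner_apply,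
    Finset.mul_sum]
  simp [xpart, mul_comm, mul_left_comm]
  ring

/-- The homogenized arrow matrix `A(x - x₀ c, ρ x₀)` of a ball, linear in `w = (x, t, x₀)`. -/
def ballArrow {n : ℕ} (c : EuclideanSpace ℝ (Fin n)) (ρ : ℝ) :
    (Idx n → ℝ) →ₗ[ℝ] Matrix (Fin n ⊕ Unit) (Fin n ⊕ Unit) ℝ where
  toFun w := arrow (xpart w - w (Sum.inr 1) • c) (ρ * w (Sum.inr 1))
  map_add' u v := by
    ext (p | p) (q | q) <;> simp [arrow, xpart] <;> ring
  map_smul' s u := by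
    ext (p | p) (q | q) <;> simp [arrow, xpart] <;> ring

/-- The part of `2ρ A(x - x₀ c, ρ x₀)` that remains after subtracting `(d ⬝ w) I`, where `d` is the
vector of the ball. It is positive semidefinite on the whole paraboloid cone. -/
noncomputable def ballRest {n : ℕ} (c : EuclideanSpace ℝ (Fin n)) (ρ : ℝ) :
    (Idx n → ℝ) →ₗ[ℝ] Matrix (Fin n ⊕ Unit) (Fin n ⊕ Unit) ℝ where
  toFun w := (2 * ρ) • ballArrow c ρ w - (dvec c ρ ⬝ᵥ w) • 1
  map_add' u v := by
    rw [map_add, dotProduct_add]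
    module
  map_smul' s u := by
    rw [map_smul, dotProduct_smul, smul_eq_mul, RingHom.id_apply]
    module

theorem ballRest_eq_arrow {n : ℕ} (c : EuclideanSpace ℝ (Fin n)) (ρ : ℝ) (w : Idx n → ℝ) :
    ballRest c ρ w = arrow ((2 * ρ) • (xpart w - w (Sum.inr 1) • c))
      (2 * ρ ^ 2 * w (Sum.inr 1) - dvec c ρ ⬝ᵥ w) := by
  change (2 * ρ) • arrow (xpart w - w (Sum.inr 1) • c) (ρ * w (Sum.inr 1)) - _ = _
  ext (p | p) (q | q) <;> simp [arrow, one_apply]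
  all_goals try split_ifs
  all_goals ring

theorem ballRest_posSemidef {n : ℕ} (c : EuclideanSpace ℝ (Fin n)) {ρ : ℝ} {w : Idx n → ℝ}
    (hw : P n *ᵥ w ∈ lorentz n) : (ballRest c ρ w).PosSemidef := by
  obtain ⟨hs, hx⟩ := (mulVec_P_mem_lorentz_iff w).1 hw
  rw [ballRest_eq_arrow]
  refine arrow_posSemidef ?_
  rw [dvec_dotProduct]
  set x := xpart w
  set t := w (Sum.inr 0)
  set x₀ := w (Sum.inr 1)
  have htx : 0 ≤ t * x₀ := (sq_nonneg _).trans hx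
  have hx₀ : 0 ≤ x₀ := by
    by_contra! hneg
    nlinarith
  have ht : 0 ≤ t := by
    by_contra! hneg
    nlinarith
  -- `(x - x₀ c, τ, x₀)` is the translate of `w` that moves the centre to the origin.
  set τ := t - 2 * inner ℝ c x + ‖c‖ ^ 2 * x₀ with hτ
  have hnorm : ‖x - x₀ • c‖ ^ 2 = ‖x‖ ^ 2 - 2 * x₀ * inner ℝ c x + x₀ ^ 2 * ‖c‖ ^ 2 := by
    rw [norm_sub_sq_real, real_inner_smul_right, real_inner_comm, norm_smul, mul_pow,
      Real.norm_eq_abs, sq_abs]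
    ring
  have hle : ‖x - x₀ • c‖ ^ 2 ≤ x₀ * τ := by
    rw [hnorm, hτ]
    nlinarith
  have hτ0 : 0 ≤ τ := by
    rcases hx₀.eq_or_lt with h0 | hpos
    · have hx0 : x = 0 := by
        rw [← h0, mul_zero] at hx
        exact norm_eq_zero.1 (pow_eq_zero_iff two_ne_zero |>.1 (le_antisymm hx (sq_nonneg _)))
      simp [hτ, hx0, ← h0, ht]
    · exact nonneg_of_mul_nonneg_right ((sq_nonneg _).trans hle) hpos
  have hgoal : 2 * ρ ^ 2 * x₀ - (2 * inner ℝ c x - t + (ρ ^ 2 - ‖c‖ ^ 2) * x₀)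
      = ρ ^ 2 * x₀ + τ := by
    rw [hτ]
    ring
  rw [hgoal]
  refine abs_le_of_sq_le_sq' ?_ (by positivity) |>.2
  rw [norm_smul, mul_pow, Real.norm_eq_abs, sq_abs]
  -- Arithmetic-geometric mean: `4ρ² x₀ τ ≤ (ρ² x₀ + τ)²`.
  nlinarith [sq_nonneg (ρ ^ 2 * x₀ - τ), mul_le_mul_of_nonneg_left hle (sq_nonneg ρ)]

theorem ballRest_kronecker_posSemidef {n : ℕ} (a b : EuclideanSpace ℝ (Fin n)) {ρ σ : ℝ}
    {w : Idx n → ℝ} (hw : 0 ≤ Matrix.toBilin' (Q n) w w) :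
    (ballRest a ρ w ⊗ₖ ballRest b σ w).PosSemidef := by
  rw [toBilin'_Q] at hw
  have hx : ‖xpart w‖ ^ 2 ≤ w (Sum.inr 0) * w (Sum.inr 1) := by linarith
  rcases le_total 0 (w (Sum.inr 0) + w (Sum.inr 1)) with h | h
  · have hw' := (mulVec_P_mem_lorentz_iff w).2 ⟨h, hx⟩
    exact (ballRest_posSemidef a hw').kronecker (ballRest_posSemidef b hw')
  · -- On the opposite nappe both factors change sign.
    have hneg : xpart (-w) = -xpart w := by
      ext k
      simp [xpart]
    have hw' : P n *ᵥ (-w) ∈ lorentz n :=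
      (mulVec_P_mem_lorentz_iff (-w)).2 ⟨by simpa [add_comm] using neg_nonneg.2 h, by simpa [hneg] using hx⟩
    have := (ballRest_posSemidef a (ρ := ρ) hw').kronecker (ballRest_posSemidef b (ρ := σ) hw')
    have hk : ∀ A B : Matrix (Fin n ⊕ Unit) (Fin n ⊕ Unit) ℝ, (-A) ⊗ₖ (-B) = A ⊗ₖ B := by
      intro A B
      ext p q
      simp
    rwa [map_neg, map_neg, hk] at this

/-! ### The Kronecker map on sums of rank-one matrices -/

theorem ballArrow_apply_eq_sum {n : ℕ} (c : EuclideanSpace ℝ (Fin n)) (ρ : ℝ) (w : Idx n → ℝ) :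
    ballArrow c ρ w = w (Sum.inr 1) • arrow (-c) ρ
      + ∑ k, w (Sum.inl k) • arrow (EuclideanSpace.single k 1) 0 := by
  change arrow (xpart w - w (Sum.inr 1) • c) (ρ * w (Sum.inr 1)) = _
  rw [arrow_sub (xpart w)]
  congr 1
  ext (p | p) (q | q) <;> simp [arrow] <;> ring

/-- The Kronecker map is linear in `Z`, and on `Z = w wᵀ` it is the Kronecker product of the two
homogenized arrow matrices. -/
theorem kronHom_sum_vecMulVec {n : ℕ} {ι : Type*} [Fintype ι] (a : EuclideanSpace ℝ (Fin n))
    (ρ : ℝ) (b : EuclideanSpace ℝ (Fin n)) (σ : ℝ) (w : ι → Idx n → ℝ) :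
    kronHom a ρ b σ (projX (∑ i, vecMulVec (w i) (w i))) (projx (∑ i, vecMulVec (w i) (w i)))
        (lastEntry (∑ i, vecMulVec (w i) (w i)))
      = ∑ i, ballArrow a ρ (w i) ⊗ₖ ballArrow b σ (w i) := by
  simp only [ballArrow_apply_eq_sum]
  ext p q
  simp only [kronHom, projX, projx, lastEntry, Matrix.add_apply, Matrix.smul_apply,
    Matrix.sum_apply, kroneckerMap_apply, vecMulVec_apply, smul_eq_mul, of_apply, Finset.sum_mul]
  rw [Finset.sum_comm (s := Finset.univ (α := Fin n)) (t := Finset.univ (α := ι))]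
  have hcomm : ∀ f : Fin n → Fin n → ι → ℝ, ∑ k, ∑ l, ∑ i, f k l i = ∑ i, ∑ k, ∑ l, f k l i :=
    fun f => (Finset.sum_congr rfl fun k _ => Finset.sum_comm).trans Finset.sum_comm
  rw [hcomm, ← Finset.sum_add_distrib, ← Finset.sum_add_distrib]
  refine Finset.sum_congr rfl fun i _ => ?_
  have e1 : ∑ k, ∑ l, w i (Sum.inl k) * w i (Sum.inl l) *
        (arrow (EuclideanSpace.single k 1) 0 p.1 q.1 * arrow (EuclideanSpace.single l 1) 0 p.2 q.2)
      = (∑ k, w i (Sum.inl k) * arrow (EuclideanSpace.single k 1) 0 p.1 q.1)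
        * ∑ l, w i (Sum.inl l) * arrow (EuclideanSpace.single l 1) 0 p.2 q.2 := by
    rw [Finset.sum_mul_sum]
    exact Finset.sum_congr rfl fun k _ => Finset.sum_congr rfl fun l _ => by ring
  have e2 : ∑ k, w i (Sum.inl k) * w i (Sum.inr 1) *
        (arrow (EuclideanSpace.single k 1) 0 p.1 q.1 * arrow (-b) σ p.2 q.2
          + arrow (-a) ρ p.1 q.1 * arrow (EuclideanSpace.single k 1) 0 p.2 q.2)
      = (∑ k, w i (Sum.inl k) * arrow (EuclideanSpace.single k 1) 0 p.1 q.1)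
          * (w i (Sum.inr 1) * arrow (-b) σ p.2 q.2)
        + w i (Sum.inr 1) * arrow (-a) ρ p.1 q.1
          * ∑ k, w i (Sum.inl k) * arrow (EuclideanSpace.single k 1) 0 p.2 q.2 := by
    rw [Finset.sum_mul, Finset.mul_sum, ← Finset.sum_add_distrib]
    exact Finset.sum_congr rfl fun k _ => by ring
  rw [e1, e2]
  ring

/-- In a ball of radius zero the constraints `⟨Q, Z⟩ = 0` and `(Z d)_{x₀} ≥ 0` force
`∑ ‖x - x₀ c‖² ≤ 0`, hence `x = x₀ c` for every rank-one summand of `Z`. -/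
theorem ballArrow_eq_zero {n : ℕ} {ι : Type*} [Fintype ι] (c : EuclideanSpace ℝ (Fin n))
    (w : ι → Idx n → ℝ) (hQ : ∑ i, Matrix.toBilin' (Q n) (w i) (w i) = 0)
    (hs : 0 ≤ ∑ i, (dvec c 0 ⬝ᵥ w i) * w i (Sum.inr 1)) (i : ι) : ballArrow c 0 (w i) = 0 := by
  have hid : ∀ i, ‖xpart (w i) - w i (Sum.inr 1) • c‖ ^ 2
      = -((dvec c 0 ⬝ᵥ w i) * w i (Sum.inr 1)) - 1 / 2 * Matrix.toBilin' (Q n) (w i) (w i) := by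
    intro i
    rw [norm_sub_sq_real, real_inner_smul_right, real_inner_comm, norm_smul, mul_pow,
      Real.norm_eq_abs, sq_abs, toBilin'_Q, dvec_dotProduct]
    ring
  have hsum : ∑ i, ‖xpart (w i) - w i (Sum.inr 1) • c‖ ^ 2 = 0 := by
    refine le_antisymm ?_ (Finset.sum_nonneg fun i _ => sq_nonneg _)
    simp only [hid]
    rw [Finset.sum_sub_distrib, Finset.sum_neg_distrib, ← Finset.mul_sum, hQ]
    linarith
  have hi := (Finset.sum_eq_zero_iff_of_nonneg fun i _ => sq_nonneg _).1 hsum i (Finset.mem_univ i)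
  have hz : xpart (w i) - w i (Sum.inr 1) • c = 0 :=
    norm_eq_zero.1 (pow_eq_zero_iff two_ne_zero |>.1 hi)
  change arrow (xpart (w i) - w i (Sum.inr 1) • c) (0 * w i (Sum.inr 1)) = 0
  rw [hz, zero_mul]
  ext (p | p) (q | q) <;> simp [arrow]

theorem sum_vecMulVec_mulVec {ι κ : Type*} [Fintype ι] [Fintype κ] (w : ι → κ → ℝ) (d : κ → ℝ) :
    (∑ i, vecMulVec (w i) (w i)) *ᵥ d = ∑ i, (d ⬝ᵥ w i) • w i := by
  rw [sum_mulVec]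
  refine Finset.sum_congr rfl fun i _ => ?_
  rw [vecMulVec_mulVec, op_smul_eq_smul, dotProduct_comm]

theorem trace_mul_sum_vecMulVec {ι κ : Type*} [Fintype ι] [Fintype κ] [DecidableEq κ]
    (M : Matrix κ κ ℝ) (w : ι → κ → ℝ) :
    trace (M * ∑ i, vecMulVec (w i) (w i)) = ∑ i, Matrix.toBilin' M (w i) (w i) := by
  rw [Finset.mul_sum, trace_sum]
  refine Finset.sum_congr rfl fun i _ => ?_
  rw [mul_vecMulVec, trace_vecMulVec, dotProduct_comm, Matrix.toBilin'_apply']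

/-- The pairwise constraints of two balls imply their Kronecker inequality. The two balls may
coincide, and then the last constraint follows from `Z` being positive semidefinite. -/
theorem kronHom_posSemidef {n : ℕ} {a b : EuclideanSpace ℝ (Fin n)} {ρ σ : ℝ} (hρ : 0 ≤ ρ)
    (hσ : 0 ≤ σ) {Z : Matrix (Idx n) (Idx n) ℝ} (hZ : Z.PosSemidef) (hQ : trace (Q n * Z) = 0)
    (ha : (P n * Z) *ᵥ dvec a ρ ∈ lorentz n) (hb : (P n * Z) *ᵥ dvec b σ ∈ lorentz n)
    (hab : 0 ≤ dvec a ρ ⬝ᵥ Z *ᵥ dvec b σ) :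
    (kronHom a ρ b σ (projX Z) (projx Z) (lastEntry Z)).PosSemidef := by
  obtain ⟨N, w, hw⟩ := posSemidef_iff_eq_sum_vecMulVec.1 hZ
  simp only [star_trivial] at hw
  subst hw
  rw [trace_mul_sum_vecMulVec] at hQ
  rw [← mulVec_mulVec, sum_vecMulVec_mulVec] at ha hb
  rw [sum_vecMulVec_mulVec, dotProduct_sum] at hab
  rw [kronHom_sum_vecMulVec]
  have hx₀ : ∀ (c : EuclideanSpace ℝ (Fin n)) (τ : ℝ),
      P n *ᵥ (∑ i, (dvec c τ ⬝ᵥ w i) • w i) ∈ lorentz n →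
        0 ≤ ∑ i, (dvec c τ ⬝ᵥ w i) * w i (Sum.inr 1) := by
    intro c τ h
    obtain ⟨h1, h2⟩ := (mulVec_P_mem_lorentz_iff _).1 h
    have h3 := (sq_nonneg _).trans h2
    have h4 : (∑ i, (dvec c τ ⬝ᵥ w i) • w i) (Sum.inr 1)
        = ∑ i, (dvec c τ ⬝ᵥ w i) * w i (Sum.inr 1) := by
      simp [Finset.sum_apply]
    rw [← h4]
    by_contra! hneg
    nlinarith
  rcases hρ.eq_or_lt with rfl | hρ
  · simp only [ballArrow_eq_zero a w hQ (hx₀ a 0 ha), zero_kronecker, Finset.sum_const_zero]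
    exact PosSemidef.zero
  rcases hσ.eq_or_lt with rfl | hσ
  · simp only [ballArrow_eq_zero b w hQ (hx₀ b 0 hb), kronecker_zero, Finset.sum_const_zero]
    exact PosSemidef.zero
  have hA : ∀ (c : EuclideanSpace ℝ (Fin n)) (τ : ℝ) (v : Idx n → ℝ),
      (2 * τ) • ballArrow c τ v = (dvec c τ ⬝ᵥ v) • 1 + ballRest c τ v := by
    intro c τ v
    exact (add_sub_cancel ((dvec c τ ⬝ᵥ v) • 1) ((2 * τ) • ballArrow c τ v)).symm
  -- In the expansion of `(2ρ A) ⊗ (2σ B)` the identity part of one factor weights the other factor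
  -- by `d ⬝ w`, so that its sum over the `w i` is the value of `ballRest` at `Z *ᵥ d`.
  have hmain : (4 * ρ * σ) • ∑ i, ballArrow a ρ (w i) ⊗ₖ ballArrow b σ (w i)
      = (∑ i, (dvec b σ ⬝ᵥ w i) * (dvec a ρ ⬝ᵥ w i)) • 1
        + 1 ⊗ₖ ballRest b σ (∑ i, (dvec a ρ ⬝ᵥ w i) • w i)
        + ballRest a ρ (∑ i, (dvec b σ ⬝ᵥ w i) • w i) ⊗ₖ 1
        + ∑ i, ballRest a ρ (w i) ⊗ₖ ballRest b σ (w i) := by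
    have hterm : ∀ i, (4 * ρ * σ) • (ballArrow a ρ (w i) ⊗ₖ ballArrow b σ (w i))
        = ((dvec b σ ⬝ᵥ w i) * (dvec a ρ ⬝ᵥ w i)) • 1
          + 1 ⊗ₖ ballRest b σ ((dvec a ρ ⬝ᵥ w i) • w i)
          + ballRest a ρ ((dvec b σ ⬝ᵥ w i) • w i) ⊗ₖ 1
          + ballRest a ρ (w i) ⊗ₖ ballRest b σ (w i) := by
      intro i
      have h1 : (4 * ρ * σ) • (ballArrow a ρ (w i) ⊗ₖ ballArrow b σ (w i))
          = ((2 * ρ) • ballArrow a ρ (w i)) ⊗ₖ ((2 * σ) • ballArrow b σ (w i)) := by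
        rw [smul_kronecker, kronecker_smul, smul_smul]
        ring_nf
      rw [h1, hA, hA, ← one_kronecker_one]
      simp only [add_kronecker, kronecker_add, smul_kronecker, kronecker_smul, map_smul]
      module
    have hL : ∀ (F : (Idx n → ℝ) →ₗ[ℝ] Matrix (Fin n ⊕ Unit) (Fin n ⊕ Unit) ℝ)
        (v : Fin N → Idx n → ℝ),
        F (∑ i, v i) ⊗ₖ (1 : Matrix (Fin n ⊕ Unit) (Fin n ⊕ Unit) ℝ) = ∑ i, F (v i) ⊗ₖ 1 := by
      intro F v
      ext p q
      simp [Matrix.sum_apply, Finset.sum_mul]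
    have hR : ∀ (F : (Idx n → ℝ) →ₗ[ℝ] Matrix (Fin n ⊕ Unit) (Fin n ⊕ Unit) ℝ)
        (v : Fin N → Idx n → ℝ),
        (1 : Matrix (Fin n ⊕ Unit) (Fin n ⊕ Unit) ℝ) ⊗ₖ F (∑ i, v i) = ∑ i, 1 ⊗ₖ F (v i) := by
      intro F v
      ext p q
      simp [Matrix.sum_apply, Finset.mul_sum]
    rw [hL, hR, Finset.smul_sum, Finset.sum_smul]
    simp only [hterm, Finset.sum_add_distrib]
  have hps : ((4 * ρ * σ) •
      ∑ i, ballArrow a ρ (w i) ⊗ₖ ballArrow b σ (w i)).PosSemidef := by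
    rw [hmain]
    refine (((PosSemidef.one.smul ?_).add (PosSemidef.one.kronecker (ballRest_posSemidef b ha))).add
      ((ballRest_posSemidef a hb).kronecker PosSemidef.one)).add ?_
    · simpa [dotProduct_smul] using hab
    · exact posSemidef_sum_kronecker (Matrix.toBilin' (Q n)) _ _
        (fun v hv => ballRest_kronecker_posSemidef a b hv)
        (fun v => by rw [ballRest_eq_arrow]; exact arrow_isHermitian _ _)
        (fun v => by rw [ballRest_eq_arrow]; exact arrow_isHermitian _ _) w hQ.ge
  have hpos : 0 < 4 * ρ * σ := by positivity
  have := hps.smul (inv_nonneg.2 hpos.le)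
  rwa [smul_smul, inv_mul_cancel₀ hpos.ne', one_smul] at this

theorem lifted_subset_liftedPair {n m : ℕ} (c : Fin m → EuclideanSpace ℝ (Fin n)) (r : Fin m → ℝ)
    (i j : Fin m) : lifted c r ⊆ liftedPair c r i j :=
  fun _ ⟨h1, h2, h3, h4⟩ => ⟨h1, h2, h3 i, h3 j, h4 i j⟩

theorem liftedPair_comm {n m : ℕ} (c : Fin m → EuclideanSpace ℝ (Fin n)) (r : Fin m → ℝ)
    (i j : Fin m) : liftedPair c r i j = liftedPair c r j i := by
  suffices h : ∀ i j, liftedPair c r i j ⊆ liftedPair c r j i from (h i j).antisymm (h j i)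
  rintro i j Z ⟨h1, h2, h3, h4, h5⟩
  refine ⟨h1, h2, h4, h3, ?_⟩
  have hT : Zᵀ = Z := by simpa using h1.isHermitian.eq
  rwa [dotProduct_mulVec, ← mulVec_transpose, hT, dotProduct_comm] at h5

theorem lifted_eq_iInter_liftedPair {n m : ℕ} (hm : 2 ≤ m) (c : Fin m → EuclideanSpace ℝ (Fin n))
    (r : Fin m → ℝ) :
    lifted c r = ⋂ i : Fin m, ⋂ j : Fin m, ⋂ _ : j < i, liftedPair c r i j := by
  refine Set.Subset.antisymm
    (Set.subset_iInter fun i => Set.subset_iInter fun j => Set.subset_iInter fun _ =>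
      lifted_subset_liftedPair c r i j) fun Z hZ => ?_
  simp only [Set.mem_iInter] at hZ
  have hne : ∀ i j, i ≠ j → Z ∈ liftedPair c r i j := by
    intro i j hij
    rcases lt_or_gt_of_ne hij with h | h
    · rw [liftedPair_comm]
      exact hZ j i h
    · exact hZ i j h
  have : Nontrivial (Fin m) := Fin.nontrivial_iff_two_le.2 hm
  have hex := fun i : Fin m => exists_ne i
  obtain ⟨i₀, j₀, h₀⟩ := exists_pair_ne (Fin m)
  have hpsd := (hne i₀ j₀ h₀).1
  refine ⟨hpsd, (hne i₀ j₀ h₀).2.1, fun i => ?_, fun i j => ?_⟩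
  · obtain ⟨j, hj⟩ := hex i
    exact (hne i j hj.symm).2.2.1
  · rcases eq_or_ne i j with rfl | hij
    · simpa using hpsd.dotProduct_mulVec_nonneg (dvec (c i) (r i))
    · exact (hne i j hij).2.2.2.2

theorem kronHom_posSemidef_of_mem_liftedPair {n m : ℕ} {c : Fin m → EuclideanSpace ℝ (Fin n)}
    {r : Fin m → ℝ} (hr : ∀ i, 0 ≤ r i) {i j : Fin m} {Z : Matrix (Idx n) (Idx n) ℝ}
    (hZ : Z ∈ liftedPair c r i j) :
    (kronHom (c i) (r i) (c j) (r j) (projX Z) (projx Z) (lastEntry Z)).PosSemidef :=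
  kronHom_posSemidef (hr i) (hr j) hZ.1 hZ.2.1 hZ.2.2.1 hZ.2.2.2.1 hZ.2.2.2.2

end BallQP

theorem theorem3p2 {n m : ℕ} (hm : 2 ≤ m) (c : Fin m → EuclideanSpace ℝ (Fin n)) (r : Fin m → ℝ)
    (hr : ∀ i, 0 ≤ r i) :
    (∀ i j : Fin m, i ≠ j → ∀ Z ∈ BallQP.liftedPair c r i j,
      (BallQP.kronHom (c i) (r i) (c j) (r j)
        (BallQP.projX Z) (BallQP.projx Z) (BallQP.lastEntry Z)).PosSemidef) ∧
    (∀ i j : Fin m, i ≠ j → ∀ Z ∈ BallQP.liftedPair c r i j, BallQP.lastEntry Z = 1 →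
      (BallQP.kron (c i) (r i) (c j) (r j) (BallQP.projX Z) (BallQP.projx Z)).PosSemidef) ∧
    BallQP.lifted c r = (⋂ i : Fin m, ⋂ j : Fin m, ⋂ _ : j < i, BallQP.liftedPair c r i j) ∧
    (∀ Z ∈ BallQP.lifted c r, ∀ i j : Fin m,
      (BallQP.kronHom (c i) (r i) (c j) (r j)
        (BallQP.projX Z) (BallQP.projx Z) (BallQP.lastEntry Z)).PosSemidef) ∧
    (∀ Z ∈ BallQP.lifted c r, BallQP.lastEntry Z = 1 → ∀ i j : Fin m,
      (BallQP.kron (c i) (r i) (c j) (r j) (BallQP.projX Z) (BallQP.projx Z)).PosSemidef) := by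
  have hkron : ∀ i j : Fin m, ∀ Z ∈ BallQP.liftedPair c r i j, BallQP.lastEntry Z = 1 →
      (BallQP.kron (c i) (r i) (c j) (r j) (BallQP.projX Z) (BallQP.projx Z)).PosSemidef := by
    intro i j Z hZ h1
    have := BallQP.kronHom_posSemidef_of_mem_liftedPair hr hZ
    rwa [h1] at this
  exact ⟨fun i j _ Z hZ => BallQP.kronHom_posSemidef_of_mem_liftedPair hr hZ,
    fun i j _ => hkron i j,
    BallQP.lifted_eq_iInter_liftedPair hm c r,
    fun Z hZ i j => BallQP.kronHom_posSemidef_of_mem_liftedPair hr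
      (BallQP.lifted_subset_liftedPair c r i j hZ),
    fun Z hZ h1 i j => hkron i j Z (BallQP.lifted_subset_liftedPair c r i j hZ) h1⟩
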